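/- Let $\Bbbk$ be a field of characteristic $0$ with algebraic closure $\overline{\Bbbk}$; all tensor products are over $\Bbbk$. Let $A$ be a unital associative $\Bbbk$-algebra and let $\mathfrak g\subset A$ be a Lie subalgebra, i.e. a linear subspace closed under the commutator $[a,b]=ab-ba$; we call $(\mathfrak g,A)$ a compatible pair. For subspaces $U,V$ of an associative algebra, $UV$ and $[U,V]$ denote the linear spans of all products $uv$, respectively of all commutators $[u,v]$, with $u\in U$, $v\in V$; in particular $\mathfrak g^k$ is the linear span of all products of $k$ elements of $\mathfrak g$ in $A$, and we put $\langle\mathfrak g\rangle=\sum_{k\ge1}\mathfrak g^k$. For an associative $\Bbbk$-algebra $\mathcal F$ (not necessarily unital) put $\mathcal F^{(0)}=\mathcal F$, $\mathcal F^{(k+1)}=[\mathcal F,\mathcal F^{(k)}]$, and for $k\ge 0$ $$I_k(\mathcal F)=\sum_{\ell\ge 1}\ \sum_{\lambda\in(\mathbb Z_{\ge0})^\ell,\ \lambda_1+\cdots+\lambda_\ell=k}\mathcal F^{(\lambda_1)}\mathcal F^{(\lambda_2)}\cdots\mathcal F^{(\lambda_\ell)} .$$ For subspaces $U\subset\mathcal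 F$, $V\subset A$ write $U\cdot V$ for the span of all $u\otimes v$ ($u\in U$, $v\in V$) in the algebra $\mathcal F\otimes A$. Let $(\mathfrak g,A)(\mathcal F)$ be the Lie subalgebra of $\mathcal F\otimes A$ (with the commutator bracket) generated by $\mathcal F\cdot\mathfrak g$. The pair $(\mathfrak g,A)$ is called perfect if $[\mathfrak g,\mathfrak g^k]\,\mathfrak g+(\mathfrak g^k\cap\mathfrak g^{k+1})=\mathfrak g^{k+1}$ for all $k\ge2$. A Lie algebra $L$ over an algebraically closed field $K$ is called strongly graded if there is $h_0\in L$ such that $\operatorname{ad}h_0$ is diagonalizable, $L=\bigoplus_{c\in K}L_c$ with $L_c$ the $c$-eigenspace of $\operatorname{ad}h_0$, and $L_0$ is spanned by the subspaces $[L_c,L_{-c}]$, $c\in K\setminus\{0\}$. Theorem. Let $(\mathfrak g,A)$ be a compatible pair. (a) If $(\mathfrak g,A)$ is perfect, then for every associative $\Bbbk$-algebra $\mathcal F$ $$(\mathfrak g,A)(\mathcal F)=\mathcal F\cdot\mathfrak g+\sum_{k\ge1}\Big(I_k(\mathcal F)\cdot[\mathfrak g,\mathfrak g^{k+1}]+[\mathcal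 F,I_{k-1}(\mathcal F)]\cdot\mathfrak g^{k+1}\Big).$$ (b) If the Lie algebra $\overline{\Bbbk}\otimes\mathfrak g$ over $\overline{\Bbbk}$ is strongly graded, then $(\mathfrak g,A)$ is perfect. (c) If $\mathfrak g$ is a finite-dimensional semisimple Lie algebra over $\Bbbk$, then for every associative $\Bbbk$-algebra $\mathcal F$ $$(\mathfrak g,A)(\mathcal F)=\mathcal F\cdot\mathfrak g+\sum_{k\ge2}\Big(I_{k-1}(\mathcal F)\cdot[\mathfrak g,\mathfrak g^k]+[\mathcal F,I_{k-2}(\mathcal F)]\cdot Z_k(\mathfrak g)\Big),$$ where $Z_k(\mathfrak g)=Z(\langle\mathfrak g\rangle)\cap\mathfrak g^k$ and $Z(\langle\mathfrak g\rangle)$ is the center of $\langle\mathfrak g\rangle$. -/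

import Mathlib

open scoped TensorProduct

-- Every associative unital algebra `A` is a Lie algebra under `⁅x, y⁆ = x * y - y * x`.  A compatible
-- pair `(𝔤, A)` is a Lie subalgebra `𝔤` of `A` for this bracket, that is, a term of
-- `LieSubalgebra k A`.
attribute [local instance 100] LieRing.ofAssociativeRing

namespace NCurrent

section NonUnital

variable (k : Type*) [Field k] {R : Type*} [NonUnitalRing R] [Module k R]

/-- `[U, V]`: the linear span of all commutators `a b - b a` with `a ∈ U`, `b ∈ V`. -/
def commSpan (U V : Submodule k R) : Submodule k R :=
  Submodule.span k {x | ∃ a ∈ U, ∃ b ∈ V, a * b - b * a = x}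

/-- `U V`: the linear span of all products `a b` with `a ∈ U`, `b ∈ V`
(for algebras that need not have a unit). -/
def mulSpan (U V : Submodule k R) : Submodule k R :=
  Submodule.span k {x | ∃ a ∈ U, ∃ b ∈ V, a * b = x}

/-- The Lie subalgebra of `R` (under the commutator bracket) generated by a subspace `S`:
the smallest subspace containing `S` and closed under commutators. -/
def lieGen (S : Submodule k R) : Submodule k R :=
  sInf {L | S ≤ L ∧ ∀ x ∈ L, ∀ y ∈ L, x * y - y * x ∈ L}

end NonUnital

section Filtration

variable (k : Type*) [Field k] (F : Type*) [NonUnitalRing F] [Module k F]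

/-- The commutator spaces `F^(0) = F`, `F^(n+1) = [F, F^(n)]`. -/
def commSpace : ℕ → Submodule k F
  | 0 => ⊤
  | n + 1 => commSpan k ⊤ (commSpace n)

/-- `prodCommSpace k F i [j₁, …, jᵣ] = F^(i) F^(j₁) ⋯ F^(jᵣ)`. -/
def prodCommSpace : ℕ → List ℕ → Submodule k F
  | i, [] => commSpace k F i
  | i, j :: l => mulSpan k (commSpace k F i) (prodCommSpace j l)

/-- `I_n(F)`: the sum of all products `F^(λ₁) ⋯ F^(λ_ℓ)` with `ℓ ≥ 1`, `λᵢ ≥ 0` and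
`λ₁ + ⋯ + λ_ℓ = n`.  The nonempty sequence is given by its head `i` and its tail `l`. -/
def commIdeal (n : ℕ) : Submodule k F :=
  ⨆ (i : ℕ) (l : List ℕ) (_ : i + l.sum = n), prodCommSpace k F i l

end Filtration

section Pair

variable {k : Type*} [Field k] {A : Type*} [Ring A] [Algebra k A]

/-- `𝔤ⁿ`: the linear span of the products of `n` elements of `𝔤` in `A`. -/
def gpow (g : LieSubalgebra k A) (n : ℕ) : Submodule k A :=
  g.toSubmodule ^ n

/-- `[𝔤, 𝔤ⁿ]`. -/
def gcomm (g : LieSubalgebra k A) (n : ℕ) : Submodule k A :=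
  commSpan k g.toSubmodule (gpow g n)

/-- A compatible pair is perfect if `[𝔤, 𝔤ⁿ] 𝔤 + (𝔤ⁿ ∩ 𝔤ⁿ⁺¹) = 𝔤ⁿ⁺¹` for all `n ≥ 2`. -/
def IsPerfect (g : LieSubalgebra k A) : Prop :=
  ∀ n : ℕ, 2 ≤ n →
    gcomm g n * g.toSubmodule ⊔ (gpow g n ⊓ gpow g (n + 1)) = gpow g (n + 1)

/-- `⟨𝔤⟩ = ∑_{n ≥ 1} 𝔤ⁿ`, the (nonunital) associative subalgebra generated by `𝔤`. -/
def assocGen (g : LieSubalgebra k A) : Submodule k A :=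
  ⨆ (n : ℕ) (_ : 1 ≤ n), gpow g n

/-- The center `Z(⟨𝔤⟩)` of `⟨𝔤⟩`. -/
def assocCenter (g : LieSubalgebra k A) : Submodule k A where
  carrier := {z | z ∈ assocGen g ∧ ∀ w ∈ assocGen g, z * w = w * z}
  zero_mem' := ⟨zero_mem _, fun w _ => by simp⟩
  add_mem' := fun {x y} hx hy =>
    ⟨add_mem hx.1 hy.1, fun w hw => by rw [add_mul, mul_add, hx.2 w hw, hy.2 w hw]⟩
  smul_mem' := fun c x hx =>
    ⟨Submodule.smul_mem _ c hx.1, fun w hw => by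
      rw [smul_mul_assoc, mul_smul_comm, hx.2 w hw]⟩

/-- `Z_n(𝔤) = Z(⟨𝔤⟩) ∩ 𝔤ⁿ`. -/
def gcenter (g : LieSubalgebra k A) (n : ℕ) : Submodule k A :=
  assocCenter g ⊓ gpow g n

/-- `U · V ⊆ F ⊗ A`: the linear span of all `f ⊗ a` with `f ∈ U`, `a ∈ V`. -/
def tens {F : Type*} [NonUnitalRing F] [Module k F] (U : Submodule k F) (V : Submodule k A) :
    Submodule k (F ⊗[k] A) :=
  Submodule.span k {x | ∃ f ∈ U, ∃ a ∈ V, f ⊗ₜ[k] a = x}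

variable (F : Type*) [NonUnitalRing F] [Module k F]

/-- `(𝔤, A)(F)`: the Lie subalgebra of `F ⊗ A` generated by `F · 𝔤`. -/
def current [IsScalarTower k F F] [SMulCommClass k F F] (g : LieSubalgebra k A) :
    Submodule k (F ⊗[k] A) :=
  lieGen k (tens (⊤ : Submodule k F) g.toSubmodule)

/-- The upper bound
`F · 𝔤 + ∑_{n ≥ 1} (I_n(F) · [𝔤, 𝔤ⁿ⁺¹] + [F, I_{n-1}(F)] · 𝔤ⁿ⁺¹)`; here `n = m + 1`. -/
def upperBound (g : LieSubalgebra k A) : Submodule k (F ⊗[k] A) :=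
  tens (⊤ : Submodule k F) g.toSubmodule ⊔
    ⨆ m : ℕ, (tens (commIdeal k F (m + 1)) (gcomm g (m + 2)) ⊔
      tens (commSpan k ⊤ (commIdeal k F m)) (gpow g (m + 2)))

/-- `F · 𝔤 + ∑_{n ≥ 2} (I_{n-1}(F) · [𝔤, 𝔤ⁿ] + [F, I_{n-2}(F)] · Z_n(𝔤))`; here `n = m + 2`. -/
def centralForm (g : LieSubalgebra k A) : Submodule k (F ⊗[k] A) :=
  tens (⊤ : Submodule k F) g.toSubmodule ⊔
    ⨆ m : ℕ, (tens (commIdeal k F (m + 1)) (gcomm g (m + 2)) ⊔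
      tens (commSpan k ⊤ (commIdeal k F m)) (gcenter g (m + 2)))

end Pair

/-- A Lie algebra `L` over a field `K` is strongly graded if for some `h₀` the operator `ad h₀` is
diagonalizable (`L` is the sum of its eigenspaces, which is then direct) and its null space is
spanned by the subspaces `[L_c, L_{-c}]` with `c ≠ 0`, `L_c` the `c`-eigenspace of `ad h₀`. -/
def IsStronglyGraded (K L : Type*) [Field K] [LieRing L] [LieAlgebra K L] : Prop :=
  ∃ h₀ : L,
    (⨆ c : K, (LieAlgebra.ad K L h₀).eigenspace c) = ⊤ ∧
    (LieAlgebra.ad K L h₀).eigenspace 0 =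
      Submodule.span K {z | ∃ c : K, c ≠ 0 ∧ ∃ x ∈ (LieAlgebra.ad K L h₀).eigenspace c,
        ∃ y ∈ (LieAlgebra.ad K L h₀).eigenspace (-c), ⁅x, y⁆ = z}

end NCurrent

/-!
The inclusion of `(𝔤, A)(F)` in the upper bound holds for every pair: the upper bound contains
`F · 𝔤` and is stable under bracketing with it, by `[f ⊗ a, f' ⊗ b] = f' f ⊗ [a, b] + [f, f'] ⊗ a b` and
the rules `F I_n + I_n F ⊆ I_n`, `[F, I_n] ⊆ I_{n+1}` (`current_le_upperBound`).

For the reverse inclusion let `(𝔤, A)` be perfect and let `L = (𝔤, A)(F)`. By induction it is shown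
that `[F, I_m] · 𝔤ⁿ ⊆ L` and `I_{m+1} · [𝔤, 𝔤ⁿ] ⊆ L` for `n = m + 2`. The first inclusion passes
from `m` to `m + 1` by bracketing `I_{m+1} · [𝔤, 𝔤ⁿ]` with `F · 𝔤`: as `I_{m+1}` is an ideal, only
`[F, I_{m+1}] · [𝔤, 𝔤ⁿ] 𝔤` is new, and perfectness yields `𝔤ⁿ⁺¹` (`tens_comm_gpow_succ_le`). The
second follows from the first for the same `m` (`tens_commIdeal_succ_gcomm_le`). Since
`I_{m+1} = [F, I_m] + F [F, I_m]` (`commIdeal_succ_le_sup`), the coefficients that matter are `f₁ [f₂, y]` with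
`y ∈ I_m`. Bracketing in two ways gives `t ⊗ [a, w] + s ⊗ w a ∈ L` for all `a ∈ 𝔤` and `w ∈ 𝔤ⁿ`,
with `s = [[f₁, f₂], y]` and `t` equal to `2 f₁ [f₂, y]` modulo `[F, I_m]`, so that it suffices to
show `s · 𝔤ⁿ⁺¹ ⊆ L`. The Jacobi identity eliminates `t` and shows that `V = {v | s ⊗ v ∈ L}`
contains `[c, w a] - [a, w] c`. Summing this over the cyclic rotations of a word of length `n + 1`
the second terms telescope, so `(n + 1) [c, 𝔤ⁿ⁺¹] ⊆ V`; hence `[𝔤, 𝔤ⁿ] 𝔤 ⊆ V`, and `𝔤ⁿ⁺¹ ⊆ V` by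
perfectness (`gpow_succ_le_of_cyclic`).

A pair with `[𝔤, 𝔤] = 𝔤` is perfect (`isPerfect_of_derivedSeries`): modulo `[𝔤, 𝔤ⁿ] 𝔤 + 𝔤ⁿ` the
expression `v [a, c] b`, with `v ∈ 𝔤ⁿ⁻¹`, is skew in `a, c` and symmetric in `c, b`, hence
zero. A strongly graded Lie algebra equals its derived algebra, and this property
descends along extensions of the ground field.

If `𝔤` is semisimple, then `[𝔤, 𝔤] = 𝔤`, and what remains is `𝔤ⁿ = [𝔤, 𝔤ⁿ] + Z_n(𝔤)`. This is the
decomposition `M = [𝔤, M] + M^𝔤` of a finite-dimensional module, proved with Casimir operators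
(`lie_top_sup_maxTrivSubmodule`); the Casimir operators come from Cartan's criterion, by which the
trace form of a module with nontrivial action is nonzero.
-/

namespace NCurrent

/-! ### Spans of products and commutators, generated Lie subalgebras -/

section NonUnital

variable {k : Type*} [Field k] {R : Type*} [NonUnitalRing R] [Module k R]

lemma commSpan_le {U V W : Submodule k R} :
    commSpan k U V ≤ W ↔ ∀ a ∈ U, ∀ b ∈ V, a * b - b * a ∈ W := by
  refine Submodule.span_le.trans ⟨fun h a ha b hb => h ⟨a, ha, b, hb, rfl⟩, ?_⟩
  rintro h _ ⟨a, ha, b, hb, rfl⟩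
  exact h a ha b hb

lemma mem_commSpan {U V : Submodule k R} {a b : R} (ha : a ∈ U) (hb : b ∈ V) :
    a * b - b * a ∈ commSpan k U V :=
  commSpan_le.1 le_rfl a ha b hb

lemma commSpan_mono {U U' V V' : Submodule k R} (hU : U ≤ U') (hV : V ≤ V') :
    commSpan k U V ≤ commSpan k U' V' :=
  commSpan_le.2 fun _ ha _ hb => mem_commSpan (hU ha) (hV hb)

lemma mulSpan_le {U V W : Submodule k R} :
    mulSpan k U V ≤ W ↔ ∀ a ∈ U, ∀ b ∈ V, a * b ∈ W := by
  refine Submodule.span_le.trans ⟨fun h a ha b hb => h ⟨a, ha, b, hb, rfl⟩, ?_⟩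
  rintro h _ ⟨a, ha, b, hb, rfl⟩
  exact h a ha b hb

lemma mem_mulSpan {U V : Submodule k R} {a b : R} (ha : a ∈ U) (hb : b ∈ V) :
    a * b ∈ mulSpan k U V :=
  mulSpan_le.1 le_rfl a ha b hb

lemma mulSpan_mono {U U' V V' : Submodule k R} (hU : U ≤ U') (hV : V ≤ V') :
    mulSpan k U V ≤ mulSpan k U' V' :=
  mulSpan_le.2 fun _ ha _ hb => mem_mulSpan (hU ha) (hV hb)

lemma le_lieGen (S : Submodule k R) : S ≤ lieGen k S :=
  le_sInf fun _ h => h.1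

lemma lieGen_comm_mem {S : Submodule k R} {x y : R} (hx : x ∈ lieGen k S)
    (hy : y ∈ lieGen k S) : x * y - y * x ∈ lieGen k S := by
  rw [lieGen, Submodule.mem_sInf] at *
  exact fun L hL => hL.2 x (hx L hL) y (hy L hL)

variable [IsScalarTower k R R] [SMulCommClass k R R]

/-- By the Jacobi identity, right-normed brackets already span the generated Lie algebra: it
suffices that `M` contains `S` and is stable under bracketing with `S`. -/
lemma lieGen_le_of_stable {S M : Submodule k R} (hSM : S ≤ M)
    (h : ∀ x ∈ S, ∀ y ∈ M, x * y - y * x ∈ M) : lieGen k S ≤ M := by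
  -- The elements of `M` that normalize `M` form a Lie subalgebra containing `S`.
  let N : Submodule k R :=
    { carrier := {x | x ∈ M ∧ ∀ y ∈ M, x * y - y * x ∈ M}
      zero_mem' := ⟨zero_mem _, fun y _ => by simp⟩
      add_mem' := fun {a b} ha hb => ⟨add_mem ha.1 hb.1, fun y hy => by
        have := add_mem (ha.2 y hy) (hb.2 y hy)
        rwa [show a * y - y * a + (b * y - y * b) = (a + b) * y - y * (a + b) by noncomm_ring]
          at this⟩
      smul_mem' := fun c a ha => ⟨M.smul_mem c ha.1, fun y hy => by
        rw [smul_mul_assoc, mul_smul_comm, ← smul_sub]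
        exact M.smul_mem c (ha.2 y hy)⟩ }
  have hN : lieGen k S ≤ N := by
    refine sInf_le ⟨fun x hx => ⟨hSM hx, h x hx⟩, fun x hx y hy => ⟨hx.2 y hy.1, fun z hz => ?_⟩⟩
    have := sub_mem (hx.2 _ (hy.2 z hz)) (hy.2 _ (hx.2 z hz))
    rwa [show x * (y * z - z * y) - (y * z - z * y) * x
      - (y * (x * z - z * x) - (x * z - z * x) * y)
      = (x * y - y * x) * z - z * (x * y - y * x) by noncomm_ring] at this
  exact fun x hx => (hN hx).1

end NonUnital

/-! ### The filtration by the ideals `I_n(F)` -/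

section Filtration

variable {k : Type*} [Field k] {F : Type*} [NonUnitalRing F] [Module k F]

lemma commSpace_succ_le (n : ℕ) : commSpace k F (n + 1) ≤ commSpace k F n := by
  induction n with
  | zero => exact le_top
  | succ n ih => exact commSpan_mono le_rfl ih

lemma prodCommSpace_le_commIdeal (i : ℕ) (l : List ℕ) :
    prodCommSpace k F i l ≤ commIdeal k F (i + l.sum) :=
  le_iSup₂_of_le i l (le_iSup_of_le rfl le_rfl)

lemma commIdeal_le {n : ℕ} {S : Submodule k F}
    (h : ∀ (l : List ℕ) (i : ℕ), i + l.sum = n → prodCommSpace k F i l ≤ S) :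
    commIdeal k F n ≤ S :=
  iSup₂_le fun i l => iSup_le fun hn => h l i hn

lemma commSpace_le_commIdeal (n : ℕ) : commSpace k F n ≤ commIdeal k F n :=
  prodCommSpace_le_commIdeal n []

lemma commIdeal_zero : commIdeal k F 0 = ⊤ :=
  top_le_iff.1 (commSpace_le_commIdeal 0)

variable [SMulCommClass k F F]

lemma commSpace_mul_commIdeal {i n : ℕ} {x y : F} (hx : x ∈ commSpace k F i)
    (hy : y ∈ commIdeal k F n) : x * y ∈ commIdeal k F (i + n) := by
  suffices commIdeal k F n ≤ (commIdeal k F (i + n)).comap (LinearMap.mulLeft k x) from this hy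
  refine commIdeal_le fun l j hj z hz => ?_
  have := prodCommSpace_le_commIdeal i (j :: l) (mem_mulSpan hx hz)
  rwa [List.sum_cons, hj] at this

lemma mul_commIdeal {n : ℕ} (x : F) {y : F} (hy : y ∈ commIdeal k F n) :
    x * y ∈ commIdeal k F n := by
  simpa using commSpace_mul_commIdeal (i := 0) (x := x) trivial hy

variable [IsScalarTower k F F]

omit [SMulCommClass k F F] in
lemma prodCommSpace_mul (l : List ℕ) (i : ℕ) {x : F} (hx : x ∈ prodCommSpace k F i l) (y : F) :
    x * y ∈ prodCommSpace k F i (l ++ [0]) := by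
  induction l generalizing i x with
  | nil => exact mem_mulSpan hx trivial
  | cons j l ih =>
    suffices prodCommSpace k F i (j :: l) ≤
      (prodCommSpace k F i (j :: (l ++ [0]))).comap (LinearMap.mulRight k y) from this hx
    refine mulSpan_le.2 fun a ha b hb => ?_
    rw [Submodule.mem_comap, LinearMap.mulRight_apply, mul_assoc]
    exact mem_mulSpan ha (ih j hb)

omit [SMulCommClass k F F] in
lemma commIdeal_mul {n : ℕ} {x : F} (hx : x ∈ commIdeal k F n) (y : F) :
    x * y ∈ commIdeal k F n := by
  suffices commIdeal k F n ≤ (commIdeal k F n).comap (LinearMap.mulRight k y) from this hx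
  refine commIdeal_le fun l i hi z hz => ?_
  have := prodCommSpace_le_commIdeal i _ (prodCommSpace_mul l i hz y)
  rwa [List.sum_append, List.sum_singleton, add_zero, hi] at this

variable (k) in
/-- `x ↦ y x - x y` as a linear map. -/
def adMap (y : F) : F →ₗ[k] F := LinearMap.mulLeft k y - LinearMap.mulRight k y

@[simp] lemma adMap_apply (y x : F) : adMap k y x = y * x - x * y := rfl

lemma comm_commIdeal {n : ℕ} (f : F) {x : F} (hx : x ∈ commIdeal k F n) :
    f * x - x * f ∈ commIdeal k F (n + 1) := by
  revert x
  change commIdeal k F n ≤ (commIdeal k F (n + 1)).comap (adMap k f)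
  refine commIdeal_le fun l i hi => ?_
  induction l generalizing i n with
  | nil =>
    intro z hz
    obtain rfl : i = n := by simpa using hi
    exact commSpace_le_commIdeal (i + 1) (mem_commSpan trivial hz)
  | cons j l ih =>
    refine mulSpan_le.2 fun a ha b hb => ?_
    have hfa : f * a - a * f ∈ commSpace k F (i + 1) := mem_commSpan trivial ha
    have h1 := commSpace_mul_commIdeal hfa (prodCommSpace_le_commIdeal j l hb)
    have h2 := commSpace_mul_commIdeal ha (ih (n := j + l.sum) j rfl hb)
    rw [List.sum_cons] at hi
    rw [show i + 1 + (j + l.sum) = n + 1 by omega] at h1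
    rw [show i + (j + l.sum + 1) = n + 1 by omega] at h2
    have := add_mem h1 h2
    rw [adMap_apply] at this
    rwa [Submodule.mem_comap, adMap_apply,
      show f * (a * b) - a * b * f = (f * a - a * f) * b + a * (f * b - b * f) by noncomm_ring]

lemma commSpan_commIdeal_le (n : ℕ) : commSpan k ⊤ (commIdeal k F n) ≤ commIdeal k F (n + 1) :=
  commSpan_le.2 fun f _ _ hx => comm_commIdeal f hx

omit [IsScalarTower k F F] in
lemma commIdeal_succ_le (n : ℕ) : commIdeal k F (n + 1) ≤ commIdeal k F n := by
  refine commIdeal_le fun l i hi => ?_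
  induction l generalizing i with
  | nil =>
    obtain rfl : i = n + 1 := by simpa using hi
    exact (commSpace_succ_le n).trans (commSpace_le_commIdeal n)
  | cons j l ih =>
    rw [List.sum_cons] at hi
    cases i with
    | zero => exact mulSpan_le.2 fun a _ b hb => mul_commIdeal a (ih j (by omega) hb)
    | succ i =>
      have := prodCommSpace_le_commIdeal (k := k) (F := F) i (j :: l)
      rw [List.sum_cons, show i + (j + l.sum) = n by omega] at this
      exact (mulSpan_mono (commSpace_succ_le i) le_rfl).trans this

omit [IsScalarTower k F F] in
lemma commSpan_commIdeal_succ_le (n : ℕ) :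
    commSpan k ⊤ (commIdeal k F (n + 1)) ≤ commSpan k ⊤ (commIdeal k F n) :=
  commSpan_mono le_rfl (commIdeal_succ_le n)

/-- `I_{n+1}` is the left ideal generated by `[F, I_n]`: repeated use of
`[f, y] x = [f, y x] - y [f, x]` lowers the commutator depth of the first nontrivial factor. -/
lemma commIdeal_succ_le_sup (n : ℕ) :
    commIdeal k F (n + 1) ≤ commSpan k ⊤ (commIdeal k F n) ⊔
      mulSpan k ⊤ (commSpan k ⊤ (commIdeal k F n)) := by
  set J := commSpan k ⊤ (commIdeal k F n)
  have hmul (f : F) {x : F} (hx : x ∈ J ⊔ mulSpan k ⊤ J) : f * x ∈ J ⊔ mulSpan k ⊤ J := by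
    suffices J ⊔ mulSpan k ⊤ J ≤ (mulSpan k ⊤ J).comap (LinearMap.mulLeft k f) from
      Submodule.mem_sup_right (this hx)
    refine sup_le (fun y hy => mem_mulSpan trivial hy) (mulSpan_le.2 fun a _ b hb => ?_)
    rw [Submodule.mem_comap, LinearMap.mulLeft_apply, ← mul_assoc]
    exact mem_mulSpan trivial hb
  have key (i : ℕ) : ∀ m, i + m = n → ∀ y ∈ commSpace k F (i + 1), ∀ x ∈ commIdeal k F m,
      y * x ∈ J ⊔ mulSpan k ⊤ J := by
    induction i with
    | zero =>
      intro m hm y hy x hx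
      suffices commSpace k F 1 ≤ (J ⊔ mulSpan k ⊤ J).comap (LinearMap.mulRight k x) from this hy
      refine commSpan_le.2 fun f _ y _ => ?_
      rw [zero_add] at hm
      subst hm
      rw [Submodule.mem_comap, LinearMap.mulRight_apply,
        show (f * y - y * f) * x = (f * (y * x) - y * x * f) - y * (f * x - x * f) by noncomm_ring]
      exact sub_mem (Submodule.mem_sup_left (mem_commSpan trivial (mul_commIdeal y hx)))
        (Submodule.mem_sup_right (mem_mulSpan trivial (mem_commSpan trivial hx)))
    | succ i ih =>
      intro m hm y hy x hx
      suffices commSpace k F (i + 1 + 1) ≤ (J ⊔ mulSpan k ⊤ J).comap (LinearMap.mulRight k x)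
        from this hy
      refine commSpan_le.2 fun f _ y hy => ?_
      rw [Submodule.mem_comap, LinearMap.mulRight_apply,
        show (f * y - y * f) * x = (f * (y * x) - y * x * f) - y * (f * x - x * f) by noncomm_ring]
      have hyx := commSpace_mul_commIdeal hy hx
      rw [hm] at hyx
      exact sub_mem (Submodule.mem_sup_left (mem_commSpan trivial hyx))
        (ih (m + 1) (by omega) y hy _ (comm_commIdeal f hx))
  refine commIdeal_le fun l i hi => ?_
  induction l generalizing i with
  | nil =>
    obtain rfl : i = n + 1 := by simpa using hi
    exact (commSpan_mono le_rfl (commSpace_le_commIdeal n)).trans le_sup_left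
  | cons j l ih =>
    rw [List.sum_cons] at hi
    cases i with
    | zero => exact mulSpan_le.2 fun a _ b hb => hmul a (ih j (by omega) hb)
    | succ i =>
      exact mulSpan_le.2 fun a ha b hb =>
        key i (j + l.sum) (by omega) a ha b (prodCommSpace_le_commIdeal j l hb)

end Filtration

/-! ### Powers of `𝔤` and the upper bound for general pairs -/

section Pair

variable {k : Type*} [Field k] {A : Type*} [Ring A] [Algebra k A]

lemma gpow_succ (g : LieSubalgebra k A) (n : ℕ) : gpow g (n + 1) = gpow g n * g.toSubmodule :=
  pow_succ _ _

lemma gpow_succ' (g : LieSubalgebra k A) (n : ℕ) : gpow g (n + 1) = g.toSubmodule * gpow g n :=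
  pow_succ' _ _

lemma gpow_one (g : LieSubalgebra k A) : gpow g 1 = g.toSubmodule := pow_one _

lemma gpow_mul_mem {g : LieSubalgebra k A} {m n : ℕ} {u v : A} (hu : u ∈ gpow g m)
    (hv : v ∈ gpow g n) : u * v ∈ gpow g (m + n) := by
  rw [gpow, pow_add]
  exact Submodule.mul_mem_mul hu hv

lemma comm_mem {g : LieSubalgebra k A} {a b : A} (ha : a ∈ g.toSubmodule)
    (hb : b ∈ g.toSubmodule) : a * b - b * a ∈ g.toSubmodule :=
  g.lie_mem ha hb

lemma comm_gpow_mem {g : LieSubalgebra k A} {n : ℕ} {a w : A} (ha : a ∈ g.toSubmodule)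
    (hw : w ∈ gpow g n) : a * w - w * a ∈ gpow g n := by
  induction n generalizing w with
  | zero =>
    obtain ⟨c, rfl⟩ := Submodule.mem_one.1 (show w ∈ (1 : Submodule k A) by simpa [gpow] using hw)
    rw [Algebra.commutes c a, sub_self]
    exact zero_mem _
  | succ n ih =>
    suffices gpow g (n + 1) ≤ (gpow g (n + 1)).comap (adMap k a) from this hw
    rw [gpow_succ, Submodule.mul_le]
    intro u hu b hb
    rw [Submodule.mem_comap, adMap_apply,
      show a * (u * b) - u * b * a = (a * u - u * a) * b + u * (a * b - b * a) by noncomm_ring]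
    exact add_mem (Submodule.mul_mem_mul (ih hu) hb) (Submodule.mul_mem_mul hu (comm_mem ha hb))

lemma gcomm_le_gpow (g : LieSubalgebra k A) (n : ℕ) : gcomm g n ≤ gpow g n :=
  commSpan_le.2 fun _ ha _ hw => comm_gpow_mem ha hw

lemma gcomm_mem {g : LieSubalgebra k A} {n : ℕ} {a w : A} (ha : a ∈ g.toSubmodule)
    (hw : w ∈ gpow g n) : a * w - w * a ∈ gcomm g n :=
  mem_commSpan ha hw

section Tens

variable {F : Type*} [NonUnitalRing F] [Module k F]

lemma tens_le {U : Submodule k F} {V : Submodule k A} {M : Submodule k (F ⊗[k] A)} :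
    tens U V ≤ M ↔ ∀ f ∈ U, ∀ a ∈ V, f ⊗ₜ[k] a ∈ M := by
  refine Submodule.span_le.trans ⟨fun h a ha b hb => h ⟨a, ha, b, hb, rfl⟩, ?_⟩
  rintro h _ ⟨a, ha, b, hb, rfl⟩
  exact h a ha b hb

lemma mem_tens {U : Submodule k F} {V : Submodule k A} {f : F} {a : A} (hf : f ∈ U) (ha : a ∈ V) :
    f ⊗ₜ[k] a ∈ tens U V :=
  tens_le.1 le_rfl f hf a ha

lemma tens_mono {U U' : Submodule k F} {V V' : Submodule k A} (hU : U ≤ U') (hV : V ≤ V') :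
    tens U V ≤ tens U' V' :=
  tens_le.2 fun _ hf _ ha => mem_tens (hU hf) (hV ha)

variable (F) in
lemma tens_gcomm_le_upperBound (g : LieSubalgebra k A) (m : ℕ) :
    tens (commIdeal k F (m + 1)) (gcomm g (m + 2)) ≤ upperBound F g :=
  le_sup_of_le_right (le_iSup_of_le m le_sup_left)

variable (F) in
lemma tens_gpow_le_upperBound (g : LieSubalgebra k A) (m : ℕ) :
    tens (commSpan k ⊤ (commIdeal k F m)) (gpow g (m + 2)) ≤ upperBound F g :=
  le_sup_of_le_right (le_iSup_of_le m le_sup_right)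

variable [IsScalarTower k F F] [SMulCommClass k F F]

lemma tmul_comm_eq (f f' : F) (a b : A) :
    f ⊗ₜ[k] a * f' ⊗ₜ[k] b - f' ⊗ₜ[k] b * f ⊗ₜ[k] a =
      (f' * f) ⊗ₜ[k] (a * b - b * a) + (f * f' - f' * f) ⊗ₜ[k] (a * b) := by
  simp only [Algebra.TensorProduct.tmul_mul_tmul, TensorProduct.tmul_sub, TensorProduct.sub_tmul]
  abel

lemma tmul_comm_eq' (f f' : F) (a b : A) :
    f ⊗ₜ[k] a * f' ⊗ₜ[k] b - f' ⊗ₜ[k] b * f ⊗ₜ[k] a =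
      (f * f') ⊗ₜ[k] (a * b - b * a) + (f * f' - f' * f) ⊗ₜ[k] (b * a) := by
  simp only [Algebra.TensorProduct.tmul_mul_tmul, TensorProduct.tmul_sub, TensorProduct.sub_tmul]
  abel

lemma current_le_upperBound (g : LieSubalgebra k A) : current F g ≤ upperBound F g := by
  refine lieGen_le_of_stable le_sup_left fun x hx => ?_
  suffices tens ⊤ g.toSubmodule ≤
      { carrier := {x | ∀ y ∈ upperBound F g, x * y - y * x ∈ upperBound F g}
        zero_mem' := fun y _ => by simp
        add_mem' := fun {a b} ha hb y hy => by
          have := add_mem (ha y hy) (hb y hy)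
          rwa [show a * y - y * a + (b * y - y * b) = (a + b) * y - y * (a + b) by noncomm_ring]
            at this
        smul_mem' := fun c a ha y hy => by
          rw [smul_mul_assoc, mul_smul_comm, ← smul_sub]
          exact Submodule.smul_mem _ c (ha y hy) : Submodule k (F ⊗[k] A) } from this hx
  refine tens_le.2 fun f _ a ha y hy => ?_
  suffices upperBound F g ≤ (upperBound F g).comap (adMap k (f ⊗ₜ[k] a)) from this hy
  refine sup_le (tens_le.2 fun f' _ b hb => ?_) (iSup_le fun m => sup_le
    (tens_le.2 fun f' hf' b hb => ?_) (tens_le.2 fun f' hf' b hb => ?_)) <;>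
    rw [Submodule.mem_comap, adMap_apply, tmul_comm_eq]
  · refine add_mem (Submodule.mem_sup_left (mem_tens trivial (comm_mem ha hb)))
      (tens_gpow_le_upperBound F g 0 (mem_tens (mem_commSpan trivial ?_) ?_))
    · simp [commIdeal_zero]
    · rw [gpow_succ, gpow_one]
      exact Submodule.mul_mem_mul ha hb
  · refine add_mem (tens_gcomm_le_upperBound F g m (mem_tens (commIdeal_mul hf' f)
      (gcomm_mem ha (gcomm_le_gpow g _ hb)))) (tens_gpow_le_upperBound F g (m + 1)
        (mem_tens (mem_commSpan trivial hf') ?_))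
    rw [gpow_succ']
    exact Submodule.mul_mem_mul ha (gcomm_le_gpow g _ hb)
  · have hf'' := commSpan_commIdeal_le m hf'
    refine add_mem (tens_gcomm_le_upperBound F g m (mem_tens (commIdeal_mul hf'' f)
      (gcomm_mem ha hb))) (tens_gpow_le_upperBound F g (m + 1)
        (mem_tens (mem_commSpan trivial hf'') ?_))
    rw [gpow_succ']
    exact Submodule.mul_mem_mul ha hb

end Tens

end Pair

/-! ### Perfect pairs attain the upper bound -/

section Perfect

variable {k : Type*} [Field k] {A : Type*} [Ring A] [Algebra k A]

lemma IsPerfect.gpow_le {g : LieSubalgebra k A} (hg : IsPerfect g) {n : ℕ} (hn : 2 ≤ n) :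
    gpow g (n + 1) ≤ gcomm g n * g.toSubmodule ⊔ gpow g n :=
  (hg n hn).ge.trans (sup_le_sup_left inf_le_left _)

/-- By the modular law, the intersection in the definition of perfectness may be dropped. -/
lemma isPerfect_of_gpow_le {g : LieSubalgebra k A}
    (h : ∀ n, 2 ≤ n → gpow g (n + 1) ≤ gcomm g n * g.toSubmodule ⊔ gpow g n) : IsPerfect g := by
  intro n hn
  have hle : gcomm g n * g.toSubmodule ≤ gpow g (n + 1) := by
    rw [gpow_succ]
    exact mul_le_mul_left (gcomm_le_gpow g n) _
  rw [← sup_inf_assoc_of_le _ hle]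
  exact inf_eq_right.2 (h n hn)

section Cyclic

variable {g : LieSubalgebra k A} {n : ℕ} {V : Submodule k A}

/-- Moving the letters of `v` one at a time from the right end of the word `u v` to its left end
telescopes the hypothesis, which is the case of one letter. -/
lemma nsmul_comm_sub_mem (hV : gpow g n ≤ V)
    (h : ∀ a ∈ g.toSubmodule, ∀ c ∈ g.toSubmodule, ∀ w ∈ gpow g n,
      (c * (w * a) - w * a * c) - (a * w - w * a) * c ∈ V)
    {c : A} (hc : c ∈ g.toSubmodule) (m : ℕ) :
    ∀ p, m + p = n → ∀ v ∈ gpow g (m + 1), ∀ u ∈ gpow g p,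
      (m + 1) • (c * (u * v) - u * v * c) - (v * u - u * v) * c ∈ V := by
  induction m with
  | zero =>
    intro p hp v hv u hu
    obtain rfl : p = n := by omega
    rw [zero_add, gpow_one] at hv
    simpa using h v hv c hc u hu
  | succ m ih =>
    intro p hp v hv u hu
    let T : A →ₗ[k] A := (m + 1 + 1) • (adMap k c ∘ₗ LinearMap.mulLeft k u) -
      LinearMap.mulRight k c ∘ₗ (LinearMap.mulRight k u - LinearMap.mulLeft k u)
    suffices gpow g (m + 1 + 1) ≤ V.comap T from this hv
    rw [gpow_succ, Submodule.mul_le]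
    intro v' hv' a ha
    have hau : a * u ∈ gpow g (p + 1) := by
      rw [gpow_succ']
      exact Submodule.mul_mem_mul ha hu
    have huv' : u * v' ∈ gpow g n := by
      have := gpow_mul_mem hu hv'
      rwa [show p + (m + 1) = n by omega] at this
    have h1 := ih (p + 1) (by omega) v' hv' (a * u) hau
    have h2 := h a ha c hc (u * v') huv'
    have h3 := V.smul_of_tower_mem (m + 1) (hV (comm_gpow_mem hc (comm_gpow_mem ha huv')))
    have h4 := sub_mem (add_mem h1 h2) h3
    simp only [Submodule.mem_comap, T, LinearMap.sub_apply, LinearMap.smul_apply,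
      LinearMap.comp_apply, adMap_apply, LinearMap.mulLeft_apply, LinearMap.mulRight_apply]
    convert h4 using 1
    simp only [succ_nsmul _ (m + 1), nsmul_eq_mul]
    noncomm_ring

variable [CharZero k]

/-- The word `v` is cyclically rotated through all its positions, so that the telescoped
hypothesis has no right-hand side left. -/
lemma comm_mem_of_cyclic (hV : gpow g n ≤ V)
    (h : ∀ a ∈ g.toSubmodule, ∀ c ∈ g.toSubmodule, ∀ w ∈ gpow g n,
      (c * (w * a) - w * a * c) - (a * w - w * a) * c ∈ V)
    {c v : A} (hc : c ∈ g.toSubmodule) (hv : v ∈ gpow g (n + 1)) : c * v - v * c ∈ V := by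
  have h1 := nsmul_comm_sub_mem hV h hc n 0 (by omega) v hv 1 (by
    rw [gpow, pow_zero]
    exact Submodule.one_le.1 le_rfl)
  rw [one_mul, mul_one, sub_self, zero_mul, sub_zero, ← Nat.cast_smul_eq_nsmul k] at h1
  exact (V.smul_mem_iff (Nat.cast_ne_zero.2 n.succ_ne_zero)).1 h1

lemma gpow_succ_le_of_cyclic (hperf : gpow g (n + 1) ≤ gcomm g n * g.toSubmodule ⊔ gpow g n)
    (hV : gpow g n ≤ V)
    (h : ∀ a ∈ g.toSubmodule, ∀ c ∈ g.toSubmodule, ∀ w ∈ gpow g n,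
      (c * (w * a) - w * a * c) - (a * w - w * a) * c ∈ V) : gpow g (n + 1) ≤ V := by
  refine hperf.trans (sup_le (Submodule.mul_le.2 fun x hx c hc => ?_) hV)
  suffices gcomm g n ≤ V.comap (LinearMap.mulRight k c) from this hx
  refine commSpan_le.2 fun a ha w hw => ?_
  have hwa : w * a ∈ gpow g (n + 1) := by
    rw [gpow_succ]
    exact Submodule.mul_mem_mul hw ha
  have := sub_mem (comm_mem_of_cyclic hV h hc hwa) (h a ha c hc w hw)
  rwa [sub_sub_cancel] at this

end Cyclic

section LowerBound

variable [CharZero k] {F : Type*} [NonUnitalRing F] [Module k F] [IsScalarTower k F F]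
  [SMulCommClass k F F] {g : LieSubalgebra k A} {L : Submodule k (F ⊗[k] A)}

omit [IsScalarTower k F F] [SMulCommClass k F F] in
/-- If `L` contains all `2 t ⊗ [a, w] + s ⊗ w a`, it contains `s ⊗ 𝔤ⁿ⁺¹`.  The terms in `t`
cancel by the Jacobi identity in `A`, which leaves a condition on words in `A` alone. -/
lemma tmul_gpow_succ_mem {n : ℕ} {s t : F}
    (hperf : gpow g (n + 1) ≤ gcomm g n * g.toSubmodule ⊔ gpow g n)
    (hs : ∀ v ∈ gpow g n, s ⊗ₜ[k] v ∈ L)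
    (h : ∀ a ∈ g.toSubmodule, ∀ w ∈ gpow g n,
      t ⊗ₜ[k] (a * w - w * a) + s ⊗ₜ[k] (w * a) ∈ L)
    {v : A} (hv : v ∈ gpow g (n + 1)) : s ⊗ₜ[k] v ∈ L := by
  suffices gpow g (n + 1) ≤ L.comap (TensorProduct.mk k F A s) from this hv
  refine gpow_succ_le_of_cyclic hperf (fun v hv => hs v hv) fun a ha c hc w hw => ?_
  have h1 := h c hc _ (comm_gpow_mem ha hw)
  have h2 := h _ (comm_mem hc ha) w hw
  have h3 := h a ha _ (comm_gpow_mem hc hw)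
  have h4 := sub_mem (add_mem h2 h3) h1
  rw [Submodule.mem_comap, TensorProduct.mk_apply]
  convert h4 using 1
  simp only [mul_sub, sub_mul, TensorProduct.tmul_sub, mul_assoc]
  abel

variable (hgen : ∀ (f : F), ∀ a ∈ g.toSubmodule, f ⊗ₜ[k] a ∈ L)
  (hclosed : ∀ x ∈ L, ∀ y ∈ L, x * y - y * x ∈ L)

include hgen hclosed

omit [CharZero k] in
lemma tens_comm_gpow_two_le : tens (commSpan k ⊤ ⊤) (gpow g 2) ≤ L := by
  refine tens_le.2 fun j hj w hw => ?_
  suffices gpow g 2 ≤ L.comap (TensorProduct.mk k F A j) from this hw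
  rw [gpow_succ, gpow_one, Submodule.mul_le]
  intro a ha b hb
  suffices commSpan k ⊤ ⊤ ≤ L.comap ((TensorProduct.mk k F A).flip (a * b)) from this hj
  refine commSpan_le.2 fun f _ f' _ => ?_
  have h1 := hclosed _ (hgen f a ha) _ (hgen f' b hb)
  rw [tmul_comm_eq] at h1
  exact (Submodule.add_mem_iff_right _ (hgen _ _ (comm_mem ha hb))).1 h1

omit [CharZero k] in
/-- From `I_m · [𝔤, 𝔤ⁿ] ⊆ L` follows `[F, I_m] · [𝔤, 𝔤ⁿ] 𝔤 ⊆ L`, since `I_m` is an ideal;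
perfectness supplies the rest of `𝔤ⁿ⁺¹`. -/
lemma tens_comm_gpow_succ_le {m n : ℕ}
    (hperf : gpow g (n + 1) ≤ gcomm g n * g.toSubmodule ⊔ gpow g n)
    (h1 : tens (commIdeal k F m) (gcomm g n) ≤ L)
    (h2 : tens (commSpan k ⊤ (commIdeal k F m)) (gpow g n) ≤ L) :
    tens (commSpan k ⊤ (commIdeal k F m)) (gpow g (n + 1)) ≤ L := by
  refine tens_le.2 fun j hj v hv => ?_
  suffices gpow g (n + 1) ≤ L.comap (TensorProduct.mk k F A j) from this hv
  refine hperf.trans (sup_le (Submodule.mul_le.2 fun w hw a ha => ?_)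
    fun v hv => h2 (mem_tens hj hv))
  suffices commSpan k ⊤ (commIdeal k F m) ≤
    L.comap ((TensorProduct.mk k F A).flip (w * a)) from this hj
  refine commSpan_le.2 fun f _ y hy => ?_
  have h3 := hclosed _ (hgen f a ha) _ (h1 (mem_tens hy hw))
  rw [tmul_comm_eq'] at h3
  exact (Submodule.add_mem_iff_right _ (h1 (mem_tens (mul_commIdeal f hy)
    (gcomm_mem ha (gcomm_le_gpow g n hw))))).1 h3

/-- Modulo `[F, I_m] · 𝔤ⁿ`, the elements `f₁ [f₂, y]` and `f₂ [y, f₁]` agree as coefficients of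
`[a, w]`. Adding the brackets of `f₁ ⊗ a` with `[f₂, y] ⊗ w` and of `f₂ ⊗ a` with `[y, f₁] ⊗ w`
gives the hypothesis of `tmul_gpow_succ_mem` with `s = [[f₁, f₂], y]`. -/
lemma tens_commIdeal_succ_gcomm_le {m n : ℕ}
    (hperf : gpow g (n + 1) ≤ gcomm g n * g.toSubmodule ⊔ gpow g n)
    (h : tens (commSpan k ⊤ (commIdeal k F m)) (gpow g n) ≤ L) :
    tens (commIdeal k F (m + 1)) (gcomm g n) ≤ L := by
  set J := commSpan k ⊤ (commIdeal k F m) with hJ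
  refine tens_le.2 fun x hx v hv => ?_
  suffices gcomm g n ≤ L.comap (TensorProduct.mk k F A x) from this hv
  refine commSpan_le.2 fun a ha w hw => ?_
  suffices J ⊔ mulSpan k ⊤ J ≤ L.comap ((TensorProduct.mk k F A).flip (a * w - w * a)) from
    this (commIdeal_succ_le_sup m hx)
  refine sup_le (fun j hj => h (mem_tens hj (comm_gpow_mem ha hw)))
    (mulSpan_le.2 fun f₁ _ j hj => ?_)
  suffices J ≤ L.comap ((TensorProduct.mk k F A).flip (a * w - w * a) ∘ₗ
    LinearMap.mulLeft k f₁) from this hj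
  refine commSpan_le.2 fun f₂ _ y hy => ?_
  change (f₁ * (f₂ * y - y * f₂)) ⊗ₜ[k] (a * w - w * a) ∈ L
  have hj₁ : f₁ * y - y * f₁ ∈ J := mem_commSpan trivial hy
  have hj₂ : f₂ * y - y * f₂ ∈ J := mem_commSpan trivial hy
  set s : F := (f₁ * f₂ - f₂ * f₁) * y - y * (f₁ * f₂ - f₂ * f₁) with hs
  have hsJ : s ∈ J := mem_commSpan trivial hy
  have hd : f₁ * (f₂ * y - y * f₂) + f₂ * (f₁ * y - y * f₁) ∈ J := by
    have := add_mem
      (mem_commSpan (Submodule.mem_top : f₁ ∈ (⊤ : Submodule k F)) (mul_commIdeal f₂ hy))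
      (mem_commSpan (Submodule.mem_top : f₂ ∈ (⊤ : Submodule k F)) (mul_commIdeal f₁ hy))
    convert this using 1
    noncomm_ring
  set t : F := f₁ * (f₂ * y - y * f₂) - f₂ * (f₁ * y - y * f₁) with ht
  have hts : ∀ a ∈ g.toSubmodule, ∀ w ∈ gpow g n,
      t ⊗ₜ[k] (a * w - w * a) + s ⊗ₜ[k] (w * a) ∈ L := by
    intro a ha w hw
    have h1 := hclosed _ (hgen f₁ a ha) _ (h (mem_tens hj₂ hw))
    have h2 := hclosed _ (hgen f₂ a ha) _ (h (mem_tens hj₁ hw))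
    rw [tmul_comm_eq'] at h1 h2
    have h3 := sub_mem h1 h2
    rw [show s = (f₁ * (f₂ * y - y * f₂) - (f₂ * y - y * f₂) * f₁)
      - (f₂ * (f₁ * y - y * f₁) - (f₁ * y - y * f₁) * f₂) by rw [hs]; noncomm_ring, ht,
      TensorProduct.sub_tmul, TensorProduct.sub_tmul]
    convert h3 using 1
    abel
  have hwa : w * a ∈ gpow g (n + 1) := by
    rw [gpow_succ]
    exact Submodule.mul_mem_mul hw ha
  have hswa := tmul_gpow_succ_mem hperf (fun v hv => h (mem_tens hsJ hv)) hts hwa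
  have ht' := (Submodule.add_mem_iff_left _ hswa).1 (hts a ha w hw)
  have h2 := add_mem (h (mem_tens hd (comm_gpow_mem ha hw))) ht'
  rw [← TensorProduct.add_tmul, ht, add_add_sub_cancel, TensorProduct.add_tmul,
    ← two_smul k] at h2
  exact (L.smul_mem_iff two_ne_zero).1 h2

omit hgen hclosed in
theorem current_eq_upperBound (hg : IsPerfect g) : current F g = upperBound F g := by
  refine le_antisymm (current_le_upperBound g) ?_
  have hgen (f : F) (a : A) (ha : a ∈ g.toSubmodule) : f ⊗ₜ[k] a ∈ current F g :=
    le_lieGen _ (mem_tens trivial ha)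
  have hclosed (x) (hx : x ∈ current F g) (y) (hy : y ∈ current F g) :
      x * y - y * x ∈ current F g := lieGen_comm_mem hx hy
  refine sup_le (le_lieGen _) (iSup_le fun m => ?_)
  suffices h : tens (commSpan k ⊤ (commIdeal k F m)) (gpow g (m + 2)) ≤ current F g from
    sup_le (tens_commIdeal_succ_gcomm_le hgen hclosed (hg.gpow_le (by omega)) h) h
  induction m with
  | zero =>
    rw [commIdeal_zero]
    exact tens_comm_gpow_two_le hgen hclosed
  | succ m ih =>
    refine tens_comm_gpow_succ_le hgen hclosed (hg.gpow_le (by omega))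
      (tens_commIdeal_succ_gcomm_le hgen hclosed (hg.gpow_le (by omega)) ih) ?_
    exact (tens_mono (commSpan_commIdeal_succ_le m) le_rfl).trans ih

end LowerBound

end Perfect

/-! ### Pairs with `[𝔤, 𝔤] = 𝔤` are perfect -/

section LiePerfect

variable {k : Type*} [Field k]

/-- A strongly graded Lie algebra equals its derived algebra: `L_c = [h₀, L_c]` for `c ≠ 0`, and
`L_0` is spanned by brackets by definition. -/
lemma IsStronglyGraded.derivedSeries_one {L : Type*} [LieRing L] [LieAlgebra k L]
    (h : IsStronglyGraded k L) : LieAlgebra.derivedSeries k L 1 = ⊤ := by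
  obtain ⟨h₀, htop, hzero⟩ := h
  have hlie (x y : L) : ⁅x, y⁆ ∈ LieAlgebra.derivedSeries k L 1 :=
    LieSubmodule.lie_mem_lie (LieSubmodule.mem_top x) (LieSubmodule.mem_top y)
  rw [← LieSubmodule.toSubmodule_eq_top, ← top_le_iff, ← htop]
  refine iSup_le fun c => ?_
  by_cases hc : c = 0
  · rw [hc, hzero, Submodule.span_le]
    rintro _ ⟨d, -, x, -, y, -, rfl⟩
    exact hlie x y
  · intro x hx
    rw [Module.End.mem_eigenspace_iff, LieAlgebra.ad_apply] at hx
    rw [← inv_smul_smul₀ hc x, ← hx]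
    exact Submodule.smul_mem _ _ (hlie h₀ x)

lemma derivedSeries_one_eq_top_of_baseChange {K L : Type*} [Field K] [Algebra k K] [LieRing L]
    [LieAlgebra k L] (h : LieAlgebra.derivedSeries K (K ⊗[k] L) 1 = ⊤) :
    LieAlgebra.derivedSeries k L 1 = ⊤ := by
  rw [LieAlgebra.derivedSeries_baseChange] at h
  refine (LieSubmodule.toSubmodule_eq_top _).1 (Submodule.eq_top_iff'.2 fun x => ?_)
  by_contra hx
  obtain ⟨f, hfx, hf⟩ := Submodule.exists_le_ker_of_notMem hx
  -- The extension of `f` to `K` vanishes on the derived algebra of `K ⊗ L`, hence everywhere.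
  have hle : (LieSubmodule.baseChange K (LieAlgebra.derivedSeries k L 1)).toSubmodule ≤
      LinearMap.ker (f.baseChange K) := by
    rw [LieSubmodule.coe_baseChange, Submodule.baseChange_eq_span, Submodule.span_le]
    rintro _ ⟨y, hy, rfl⟩
    simpa using congrArg ((1 : K) ⊗ₜ[k] ·) (hf hy)
  rw [h] at hle
  have hfx1 : (1 : K) ⊗ₜ[k] f x = 0 := hle (show (1 : K) ⊗ₜ[k] x ∈ _ from trivial)
  have := congrArg (TensorProduct.rid k K) hfx1
  simp [hfx] at this

variable {A : Type*} [Ring A] [Algebra k A] {g : LieSubalgebra k A}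

lemma le_commSpan_of_derivedSeries (h : LieAlgebra.derivedSeries k g 1 = ⊤) :
    g.toSubmodule ≤ commSpan k g.toSubmodule g.toSubmodule := by
  intro x hx
  have h1 : (⟨x, hx⟩ : g) ∈ (LieAlgebra.derivedSeries k g 1).toSubmodule := by
    rw [h]
    trivial
  change _ ∈ (⁅(⊤ : LieIdeal k g), (⊤ : LieIdeal k g)⁆ : LieIdeal k g).toSubmodule at h1
  rw [LieSubmodule.lieIdeal_oper_eq_linear_span] at h1
  suffices Submodule.span k _ ≤ (commSpan k g.toSubmodule g.toSubmodule).comap g.toSubmodule.subtype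
    from this h1
  refine Submodule.span_le.2 ?_
  rintro _ ⟨a, b, rfl⟩
  exact mem_commSpan a.1.2 b.1.2

/-- Modulo `[𝔤, 𝔤ⁿ⁺¹] 𝔤 + 𝔤ⁿ⁺¹` the expression `v [a, c] b` is skew in `a, c` and symmetric in
`c, b`, so it vanishes. -/
lemma mul_comm_mul_mem [CharZero k] {n : ℕ} {v a b c : A} (hv : v ∈ gpow g n)
    (ha : a ∈ g.toSubmodule) (hb : b ∈ g.toSubmodule) (hc : c ∈ g.toSubmodule) :
    v * (a * c - c * a) * b ∈ gcomm g (n + 1) * g.toSubmodule ⊔ gpow g (n + 1) := by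
  set X := gcomm g (n + 1) * g.toSubmodule ⊔ gpow g (n + 1) with hX
  have hmul {w x : A} (hw : w ∈ gpow g n) (hx : x ∈ g.toSubmodule) : w * x ∈ gpow g (n + 1) := by
    rw [gpow_succ]
    exact Submodule.mul_mem_mul hw hx
  have hsymm {x y z : A} (hx : x ∈ g.toSubmodule) (hy : y ∈ g.toSubmodule)
      (hz : z ∈ g.toSubmodule) :
      v * (x * y - y * x) * z - v * (x * z - z * x) * y ∈ X := by
    have h1 : (x * (v * y) - v * y * x) * z ∈ X :=
      Submodule.mem_sup_left (Submodule.mul_mem_mul (gcomm_mem hx (hmul hv hy)) hz)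
    have h2 : (x * (v * z) - v * z * x) * y ∈ X :=
      Submodule.mem_sup_left (Submodule.mul_mem_mul (gcomm_mem hx (hmul hv hz)) hy)
    have h3 : (x * v - v * x) * (y * z - z * y) ∈ X :=
      Submodule.mem_sup_right (hmul (comm_gpow_mem hx hv) (comm_mem hy hz))
    convert sub_mem (sub_mem h1 h2) h3 using 1
    noncomm_ring
  have h2 := add_mem (sub_mem (hsymm ha hc hb) (hsymm hb ha hc)) (hsymm hc hb ha)
  rw [← X.smul_mem_iff (two_ne_zero' k), two_smul]
  convert h2 using 1
  noncomm_ring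

lemma isPerfect_of_derivedSeries [CharZero k] (h : LieAlgebra.derivedSeries k g 1 = ⊤) :
    IsPerfect g := by
  refine isPerfect_of_gpow_le fun n hn => ?_
  obtain ⟨n, rfl⟩ : ∃ m, n = m + 1 := ⟨n - 1, by omega⟩
  rw [gpow_succ _ (n + 1), Submodule.mul_le]
  intro w hw b hb
  suffices gpow g (n + 1) ≤ (gcomm g (n + 1) * g.toSubmodule ⊔ gpow g (n + 1)).comap
    (LinearMap.mulRight k b) from this hw
  rw [gpow_succ, Submodule.mul_le]
  intro v hv x hx
  suffices commSpan k g.toSubmodule g.toSubmodule ≤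
    (gcomm g (n + 1) * g.toSubmodule ⊔ gpow g (n + 1)).comap
      (LinearMap.mulRight k b ∘ₗ LinearMap.mulLeft k v) from
    this (le_commSpan_of_derivedSeries h hx)
  exact commSpan_le.2 fun a ha c hc => mul_comm_mul_mem hv ha hb hc

end LiePerfect

/-! ### Casimir operators and invariants of modules over semisimple Lie algebras -/

section Casimir

variable {k : Type*} [Field k] {L : Type*} [LieRing L] [LieAlgebra k L]

open LieModule

lemma derivedSeries_one_eq_top_of_isKilling [LieAlgebra.IsKilling k L] [FiniteDimensional k L] :
    LieAlgebra.derivedSeries k L 1 = ⊤ := by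
  set D := LieAlgebra.derivedSeries k L 1
  have hc := LieIdeal.isCompl_killingCompl D
  have hab : IsLieAbelian (LieIdeal.killingCompl k L D) := by
    refine ⟨fun x y => Subtype.ext ?_⟩
    have h1 : ⁅(x : L), (y : L)⁆ ∈ D := LieSubmodule.lie_mem_lie trivial trivial
    have h2 : ⁅(x : L), (y : L)⁆ ∈ LieIdeal.killingCompl k L D := LieSubmodule.lie_mem _ y.2
    have h3 : ⁅(x : L), (y : L)⁆ ∈ D ⊓ LieIdeal.killingCompl k L D := ⟨h1, h2⟩
    rw [hc.inf_eq_bot] at h3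
    exact (LieSubmodule.mem_bot _).1 h3
  have h := hc.sup_eq_top
  rwa [LieAlgebra.IsKilling.ideal_eq_bot_of_isLieAbelian (LieIdeal.killingCompl k L D),
    sup_bot_eq] at h

variable {M : Type*} [AddCommGroup M] [Module k M] [LieRingModule L M] [LieModule k L M]

lemma isTrivial_of_isNilpotent (hL : LieAlgebra.derivedSeries k L 1 = ⊤)
    [LieModule.IsNilpotent L M] : LieModule.IsTrivial L M := by
  have hstep : lowerCentralSeries k L M 1 ≤ lowerCentralSeries k L M 2 := by
    change ⁅(⊤ : LieIdeal k L), (⊤ : LieSubmodule k L M)⁆ ≤ ⁅(⊤ : LieIdeal k L), ⁅⊤, ⊤⁆⁆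
    nth_rewrite 1 [← hL]
    rw [LieSubmodule.lie_le_iff]
    intro x hx m _
    have hx' : x ∈ (⁅(⊤ : LieIdeal k L), (⊤ : LieIdeal k L)⁆ : LieIdeal k L).toSubmodule := hx
    rw [LieSubmodule.lieIdeal_oper_eq_linear_span] at hx'
    clear hx
    induction hx' using Submodule.span_induction with
    | mem x h =>
      obtain ⟨a, b, rfl⟩ := h
      rw [lie_lie]
      exact sub_mem
        (LieSubmodule.lie_mem_lie trivial (LieSubmodule.lie_mem_lie trivial trivial))
        (LieSubmodule.lie_mem_lie trivial (LieSubmodule.lie_mem_lie trivial trivial))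
    | zero => simp
    | add x y _ _ hx hy =>
      rw [add_lie]
      exact add_mem hx hy
    | smul c x _ hx =>
      rw [smul_lie]
      exact Submodule.smul_mem _ _ hx
  have hall (n : ℕ) : lowerCentralSeries k L M 1 ≤ lowerCentralSeries k L M (n + 1) := by
    induction n with
    | zero => exact le_rfl
    | succ n ih =>
      refine hstep.trans ?_
      rw [LieModule.lowerCentralSeries_succ, LieModule.lowerCentralSeries_succ k L M (n + 1)]
      exact LieSubmodule.mono_lie_right ⊤ ih
  obtain ⟨n, hn⟩ := (isNilpotent_iff k L M).1 ‹_›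
  refine ⟨fun x m => ?_⟩
  have h1 : ⁅x, m⁆ ∈ lowerCentralSeries k L M 1 := LieSubmodule.lie_mem_lie trivial trivial
  have h2 := antitone_lowerCentralSeries k L M n.le_succ (hall n h1)
  rw [hn] at h2
  exact (LieSubmodule.mem_bot _).1 h2

variable [FiniteDimensional k M]

lemma isTrivial_of_traceForm_eq_zero [CharZero k] (hL : LieAlgebra.derivedSeries k L 1 = ⊤)
    (h : traceForm k L M = 0) : LieModule.IsTrivial L M := by
  have h1 := isNilpotent_derivedSeries_of_traceForm_eq_zero h
  have h2 : LieModule.IsNilpotent L M := by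
    rw [isNilpotent_iff_forall' (R := k)] at h1 ⊢
    intro x
    exact h1 ⟨x, by rw [hL]; trivial⟩
  exact isTrivial_of_isNilpotent hL

variable [FiniteDimensional k L]

omit [FiniteDimensional k M] in
/-- The Killing-orthogonal complement of the radical of the trace form is an ideal on which the
trace form is nondegenerate. -/
lemma exists_ideal_restrict_traceForm_nondegenerate [LieAlgebra.IsKilling k L]
    (h : traceForm k L M ≠ 0) :
    ∃ J : LieIdeal k L, J ≠ ⊥ ∧
      ∀ x ∈ J, (∀ y ∈ J, traceForm k L M x y = 0) → x = 0 := by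
  set I : LieIdeal k L := LieAlgebra.InvariantForm.orthogonal (traceForm k L M)
    (traceForm_lieInvariant k L M) ⊤ with hI
  have hmem (x : L) : x ∈ I ↔ ∀ y, traceForm k L M y x = 0 := by
    simp [hI, LieAlgebra.InvariantForm.mem_orthogonal]
  have hc := LieIdeal.isCompl_killingCompl I
  refine ⟨LieIdeal.killingCompl k L I, fun hbot => h ?_, fun x hx hxJ => ?_⟩
  · rw [hbot] at hc
    have hItop : I = ⊤ := by simpa using hc.sup_eq_top
    ext y x
    exact (hmem x).1 (hItop ▸ trivial) y
  · have hxI : x ∈ I := by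
      refine (hmem x).2 fun y => ?_
      have hy : y ∈ I ⊔ LieIdeal.killingCompl k L I := hc.sup_eq_top ▸ trivial
      obtain ⟨a, ha, b, hb, rfl⟩ := (LieSubmodule.mem_sup _ _ _).1 hy
      rw [map_add, LinearMap.add_apply, traceForm_comm k L M a, (hmem a).1 ha,
        traceForm_comm k L M b, hxJ b hb, add_zero]
    have h3 : x ∈ I ⊓ LieIdeal.killingCompl k L I := ⟨hxI, hx⟩
    rw [hc.inf_eq_bot] at h3
    exact (LieSubmodule.mem_bot _).1 h3

omit [FiniteDimensional k M] in
/-- The Casimir operator `∑ᵢ bᵢ bⁱ` of an ideal `J` on which the trace form of `M` is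
nondegenerate, for a basis `bᵢ` of `J` and its dual basis `bⁱ`. -/
lemma exists_casimir {J : LieIdeal k L}
    (hJ : ∀ x ∈ J, (∀ y ∈ J, traceForm k L M x y = 0) → x = 0) :
    ∃ Ω : Module.End k M, (∀ (z : L) (m : M), Ω ⁅z, m⁆ = ⁅z, Ω m⁆) ∧
      (∀ m, Ω m ∈ ⁅(⊤ : LieIdeal k L), (⊤ : LieSubmodule k L M)⁆) ∧
      LinearMap.trace k M Ω = Module.finrank k J := by
  classical
  set τ := traceForm k L M with hτ
  let B : LinearMap.BilinForm k J := τ.restrict J.toSubmodule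
  have hBs : B.IsSymm := ⟨fun x y => traceForm_comm k L M x y⟩
  have hB : B.Nondegenerate := by
    refine hBs.isRefl.nondegenerate_iff_separatingLeft.2 fun x hx => ?_
    exact Subtype.ext (hJ x x.2 fun y hy => hx ⟨y, hy⟩)
  let b := Module.finBasis k J
  let d := B.dualBasis hB b
  -- Applied to `b` and to `d`, this expands the elements of `J` in each of the two bases.
  have hexp (e : Module.Basis (Fin (Module.finrank k J)) k J) (x : L) (hx : x ∈ J) :
      x = ∑ j, τ x (e j) • (B.dualBasis hB e j : L) := by
    have h := (B.dualBasis hB e).sum_repr ⟨x, hx⟩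
    simp only [LinearMap.BilinForm.dualBasis_repr_apply] at h
    simpa using! (congrArg (fun y : J => (y : L)) h).symm
  have hd := hexp b
  have hb := hexp d
  rw [show B.dualBasis hB d = b from LinearMap.BilinForm.dualBasis_dualBasis hB hBs b] at hb
  refine ⟨∑ i, toEnd k L M (b i) ∘ₗ toEnd k L M (d i), fun z m => ?_, fun m => ?_, ?_⟩
  · have hz (i) : ⁅z, (b i : L)⁆ = ∑ j, τ ⁅z, (b i : L)⁆ (d j) • (b j : L) :=
      hb _ (LieSubmodule.lie_mem _ (b i).2)
    have hz' (i) : ⁅z, (d i : L)⁆ = ∑ j, τ ⁅z, (d i : L)⁆ (b j) • (d j : L) :=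
      hd _ (LieSubmodule.lie_mem _ (d i).2)
    -- The two contributions to `[z, Ω]` cancel, as `ad z` is skew for the trace form.
    have h0 : ∑ i, (⁅⁅z, (b i : L)⁆, ⁅(d i : L), m⁆⁆ + ⁅(b i : L), ⁅⁅z, (d i : L)⁆, m⁆⁆) = 0 := by
      rw [Finset.sum_add_distrib]
      conv_lhs =>
        enter [1, 2, i]
        rw [hz i, sum_lie]
      conv_lhs =>
        enter [2, 2, i]
        rw [hz' i, sum_lie, lie_sum]
      rw [Finset.sum_comm, ← Finset.sum_add_distrib]
      refine Finset.sum_eq_zero fun i _ => ?_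
      rw [← Finset.sum_add_distrib]
      refine Finset.sum_eq_zero fun j _ => ?_
      rw [smul_lie, smul_lie, lie_smul, ← add_smul, hτ, traceForm_apply_lie_apply',
        traceForm_comm k L M (b j), neg_add_cancel, zero_smul]
    simp only [LinearMap.sum_apply, LinearMap.comp_apply, toEnd_apply_apply, lie_sum]
    rw [← sub_eq_zero, ← Finset.sum_sub_distrib, ← neg_eq_zero, ← Finset.sum_neg_distrib, ← h0]
    refine Finset.sum_congr rfl fun i _ => ?_
    rw [leibniz_lie z (b i : L), leibniz_lie z (d i : L) m, lie_add]
    abel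
  · rw [LinearMap.sum_apply]
    exact sum_mem fun i _ => LieSubmodule.lie_mem_lie trivial trivial
  · rw [map_sum]
    have h1 (i) : LinearMap.trace k M (toEnd k L M (b i) ∘ₗ toEnd k L M (d i)) = 1 := by
      rw [← traceForm_apply_apply]
      change B (b i) (d i) = 1
      simp [d, LinearMap.BilinForm.apply_dualBasis_right hB hBs]
    simp [h1]

omit [FiniteDimensional k M] in
/-- A finite-dimensional module over a semisimple Lie algebra is the sum of `[L, M]` and the
invariants. If `L` acts nontrivially, a Casimir operator `Ω` has nonzero trace, so `M` is the sum
of the range of some `Ωⁿ`, which lies in `[L, M]`, and its kernel, a proper submodule. -/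
theorem lie_top_sup_maxTrivSubmodule [CharZero k] [LieAlgebra.IsKilling k L] (n : ℕ) :
    ∀ (M : Type*) [AddCommGroup M] [Module k M] [LieRingModule L M] [LieModule k L M]
      [FiniteDimensional k M], Module.finrank k M = n →
      ⁅(⊤ : LieIdeal k L), (⊤ : LieSubmodule k L M)⁆ ⊔ maxTrivSubmodule k L M = ⊤ := by
  induction n using Nat.strong_induction_on with
  | h n ih =>
    intro M _ _ _ _ _ hn
    by_cases hτ : traceForm k L M = 0
    · have := isTrivial_of_traceForm_eq_zero derivedSeries_one_eq_top_of_isKilling hτ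
      rw [(isTrivial_iff_max_triv_eq_top k L M).1 this, sup_top_eq]
    obtain ⟨J, hJbot, hJ⟩ := exists_ideal_restrict_traceForm_nondegenerate hτ
    obtain ⟨Ω, hΩ, hΩmem, htr⟩ := exists_casimir hJ
    obtain ⟨p, hp, hcompl⟩ := ((Filter.eventually_ge_atTop 1).and
      Ω.eventually_isCompl_ker_pow_range_pow).exists
    have hpow (q : ℕ) (z : L) (m : M) : (Ω ^ q) ⁅z, m⁆ = ⁅z, (Ω ^ q) m⁆ := by
      induction q with
      | zero => simp
      | succ q ihq => rw [pow_succ', Module.End.mul_apply, ihq, hΩ, Module.End.mul_apply]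
    let N : LieSubmodule k L M :=
      { LinearMap.ker (Ω ^ p) with
        lie_mem := fun {z m} hm => by
          change (Ω ^ p) ⁅z, m⁆ = 0
          rw [hpow, show (Ω ^ p) m = 0 from hm, lie_zero] }
    have hlt : Module.finrank k N < n := by
      rw [← hn]
      refine Submodule.finrank_lt (s := N.toSubmodule) fun htop => ?_
      have hnil : IsNilpotent Ω := ⟨p, LinearMap.ker_eq_top.1 htop⟩
      have h0 := (LinearMap.isNilpotent_trace_of_isNilpotent hnil).eq_zero
      rw [htr, Nat.cast_eq_zero] at h0
      exact hJbot ((LieSubmodule.toSubmodule_eq_bot _).1 (Submodule.finrank_eq_zero.1 h0))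
    have hN := ih _ hlt N rfl
    rw [← top_le_iff]
    intro m _
    have hm : m ∈ LinearMap.ker (Ω ^ p) ⊔ LinearMap.range (Ω ^ p) := hcompl.sup_eq_top ▸ trivial
    obtain ⟨x, hx, _, ⟨y, rfl⟩, rfl⟩ := Submodule.mem_sup.1 hm
    refine add_mem ?_ ((le_sup_left : ⁅(⊤ : LieIdeal k L), (⊤ : LieSubmodule k L M)⁆ ≤ _) ?_)
    · have hx' : (⟨x, hx⟩ : N) ∈ ⁅(⊤ : LieIdeal k L), (⊤ : LieSubmodule k L N)⁆ ⊔
          maxTrivSubmodule k L N := by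
        rw [hN]
        trivial
      obtain ⟨u, hu, v, hv, huv⟩ := (LieSubmodule.mem_sup _ _ _).1 hx'
      have hx2 : x = N.incl u + N.incl v := by
        rw [← map_add, huv]
        rfl
      rw [hx2]
      refine add_mem ((le_sup_left : ⁅(⊤ : LieIdeal k L), (⊤ : LieSubmodule k L M)⁆ ≤ _) ?_)
        ((le_sup_right : maxTrivSubmodule k L M ≤ _) fun z => ?_)
      · have := LieSubmodule.mem_map_of_mem (f := N.incl) hu
        rw [LieSubmodule.map_bracket_eq] at this
        exact LieSubmodule.mono_lie_right ⊤ le_top this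
      · rw [← LieModuleHom.map_lie, hv z, map_zero]
    · obtain ⟨q, rfl⟩ : ∃ q, p = q + 1 := ⟨p - 1, by omega⟩
      rw [pow_succ', Module.End.mul_apply]
      exact hΩmem _

end Casimir

/-! ### Semisimple `𝔤` and the central form -/

section Semisimple

variable {k : Type*} [Field k] [CharZero k] {A : Type*} [Ring A] [Algebra k A]
  {g : LieSubalgebra k A}

omit [CharZero k] in
lemma mem_assocCenter_of_comm {z : A} (hz : z ∈ assocGen g)
    (h : ∀ x ∈ g.toSubmodule, z * x = x * z) : z ∈ assocCenter g := by
  refine ⟨hz, fun w hw => ?_⟩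
  suffices assocGen g ≤ LinearMap.ker (adMap k z) from sub_eq_zero.1 (this hw)
  refine iSup₂_le fun n _ => ?_
  rw [gpow]
  have hpow (n : ℕ) : g.toSubmodule ^ n ≤ LinearMap.ker (adMap k z) := by
    induction n with
    | zero =>
      rw [pow_zero, Submodule.one_le, LinearMap.mem_ker, adMap_apply, mul_one, one_mul, sub_self]
    | succ n ih =>
      rw [pow_succ, Submodule.mul_le]
      intro u hu x hx
      have hu' : z * u = u * z := sub_eq_zero.1 (ih hu)
      rw [LinearMap.mem_ker, adMap_apply, ← mul_assoc, hu', mul_assoc, h x hx, mul_assoc, sub_self]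
  exact hpow n

/-- `𝔤ⁿ` is a finite-dimensional module over the semisimple Lie algebra `𝔤`, and its invariants
are central in `⟨𝔤⟩`. -/
lemma gpow_eq_gcomm_sup_gcenter [FiniteDimensional k g] [LieAlgebra.IsKilling k g] {n : ℕ}
    (hn : 1 ≤ n) : gpow g n = gcomm g n ⊔ gcenter g n := by
  refine le_antisymm (fun w hw => ?_) (sup_le (gcomm_le_gpow g n) inf_le_right)
  let P : LieSubmodule k g A :=
    { gpow g n with lie_mem := fun {x w} hw => comm_gpow_mem x.2 hw }
  have hfin : FiniteDimensional k P := by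
    have hg : g.toSubmodule.FG := Module.Finite.iff_fg.1 ‹FiniteDimensional k g›
    exact Module.Finite.iff_fg.2 (hg.pow n)
  have hw' : (⟨w, hw⟩ : P) ∈ ⁅(⊤ : LieIdeal k g), (⊤ : LieSubmodule k g P)⁆ ⊔
      LieModule.maxTrivSubmodule k g P :=
    (lie_top_sup_maxTrivSubmodule (L := g) (Module.finrank k P) P rfl).ge trivial
  obtain ⟨u, hu, v, hv, huv⟩ := (LieSubmodule.mem_sup _ _ _).1 hw'
  have hw2 : w = u + v := congrArg Subtype.val huv.symm
  rw [hw2]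
  refine add_mem (Submodule.mem_sup_left ?_) (Submodule.mem_sup_right ⟨?_, v.2⟩)
  · have hu' : u ∈ (⁅(⊤ : LieIdeal k g), (⊤ : LieSubmodule k g P)⁆).toSubmodule := hu
    rw [LieSubmodule.lieIdeal_oper_eq_linear_span] at hu'
    suffices Submodule.span k _ ≤ (gcomm g n).comap P.toSubmodule.subtype from this hu'
    refine Submodule.span_le.2 ?_
    rintro _ ⟨a, b, rfl⟩
    exact gcomm_mem a.1.2 b.1.2
  · refine mem_assocCenter_of_comm ((le_iSup₂_of_le n hn le_rfl : gpow g n ≤ assocGen g) v.2)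
      fun x hx => ?_
    have := congrArg Subtype.val (hv ⟨x, hx⟩)
    exact (sub_eq_zero.1 (show x * v - v * x = 0 from this)).symm

lemma upperBound_eq_centralForm [FiniteDimensional k g] [LieAlgebra.IsKilling k g]
    (F : Type*) [NonUnitalRing F] [Module k F] [IsScalarTower k F F] [SMulCommClass k F F] :
    upperBound F g = centralForm F g := by
  unfold upperBound centralForm
  congr 2
  funext m
  refine le_antisymm (sup_le le_sup_left (tens_le.2 fun j hj w hw => ?_))
    (sup_le_sup_left (tens_mono le_rfl inf_le_right) _)
  rw [gpow_eq_gcomm_sup_gcenter (by omega)] at hw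
  obtain ⟨u, hu, v, hv, rfl⟩ := Submodule.mem_sup.1 hw
  rw [TensorProduct.tmul_add]
  exact add_mem (Submodule.mem_sup_left (mem_tens (commSpan_commIdeal_le m hj) hu))
    (Submodule.mem_sup_right (mem_tens hj hv))

end Semisimple

end NCurrent

theorem mainTheorem1 {k : Type*} [Field k] [CharZero k] {A : Type*} [Ring A] [Algebra k A]
    (g : LieSubalgebra k A) :
    (NCurrent.IsPerfect g →
      ∀ (F : Type*) [NonUnitalRing F] [Module k F] [IsScalarTower k F F] [SMulCommClass k F F],
        NCurrent.current F g = NCurrent.upperBound F g) ∧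
    (NCurrent.IsStronglyGraded (AlgebraicClosure k) (TensorProduct k (AlgebraicClosure k) g) →
      NCurrent.IsPerfect g) ∧
    (FiniteDimensional k g → LieAlgebra.IsSemisimple k g →
      ∀ (F : Type*) [NonUnitalRing F] [Module k F] [IsScalarTower k F F] [SMulCommClass k F F],
        NCurrent.current F g = NCurrent.centralForm F g) := by
  refine ⟨fun hg F _ _ _ _ => NCurrent.current_eq_upperBound hg, fun hg => ?_,
    fun _ _ F _ _ _ _ => ?_⟩
  · exact NCurrent.isPerfect_of_derivedSeries
      (NCurrent.derivedSeries_one_eq_top_of_baseChange hg.derivedSeries_one)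
  · rw [NCurrent.current_eq_upperBound (NCurrent.isPerfect_of_derivedSeries
      NCurrent.derivedSeries_one_eq_top_of_isKilling), NCurrent.upperBound_eq_centralForm]
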